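/- Let $\Xi=\Xi_1\times\cdots\times\Xi_N$ be a finite sample space in which every scenario $\xi=(\xi_1,\dots,\xi_N)$ has probability $p(\xi)>0$, with $\sum_{\xi}p(\xi)=1$; enumerate $\Xi=\{\xi^1,\dots,\xi^J\}$. Let $n=n_1+\dots+n_N$ and let $\mathcal L_n$ be the Hilbert space of all maps $x(\cdot)=(x_1(\cdot),\dots,x_N(\cdot)):\Xi\to\mathbb R^{n}=\mathbb R^{n_1}\times\cdots\times\mathbb R^{n_N}$ with inner product $\langle x(\cdot),w(\cdot)\rangle=\sum_{\xi}p(\xi)\sum_{k=1}^N\langle x_k(\xi),w_k(\xi)\rangle$. Let $\mathcal N_n=\{x(\cdot): x_k(\xi)\text{ does not depend on }\xi_k,\dots,\xi_N,\ k=1,\dots,N\}$ and let $\mathcal M_n=\{w(\cdot): E_{\xi|\xi_1,\dots,\xi_{k-1}}w_k(\xi)=0,\ k=1,\dots,N\}$ be its orthogonal complement, with $P_{\mathcal M_n}$ the orthogonal projection onto $\mathcal M_n$. For each $\xi$ let $C(\xi)\subset\mathbb R^n$ be nonempty, closed and convex, and put $\mathcal C=\{x(\cdot): x(\xi)\in C(\xi)\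 \forall\xi\}$. Given functions $F(\cdot,\xi):\mathbb R^n\to\mathbb R^n$, put $\mathcal F(x(\cdot)):\xi\mapsto F(x(\xi),\xi)$. Let $\bar n=nJ$, let $\phi:\mathcal L_n\to\mathbb R^{\bar n}$ be the linear isometry $\phi(x(\cdot))=(\sqrt{p(\xi^1)}\,x(\xi^1),\dots,\sqrt{p(\xi^J)}\,x(\xi^J))$, and for $x=(x_{p_1},\dots,x_{p_J})\in\mathbb R^{\bar n}$ with $x_{p_i}\in\mathbb R^n$ let $$\hat F(x)=\Big(\sqrt{p(\xi^1)}\,F\big(\tfrac{1}{\sqrt{p(\xi^1)}}x_{p_1},\xi^1\big),\dots,\sqrt{p(\xi^J)}\,F\big(\tfrac{1}{\sqrt{p(\xi^J)}}x_{p_J},\xi^J\big)\Big).$$ Let $\mathcal C_0\supset\mathcal C$ be an open convex set in $\mathcal L_n$ such that $\mathcal F$ is continuously differentiable on $\mathcal C_0$ and pseudomonotone on $\mathcal C_0$, i.e. for all $x(\cdot),y(\cdot)\in\mathcal C_0$, $\langle y(\cdot)-x(\cdot),\mathcal F(x(\cdot))\rangle\ge 0$ implies $\langle y(\cdot)-x(\cdot),\mathcal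 F(y(\cdot))\rangle\ge0$. Assume that the Jacobian matrix $D\hat F(x)$ is symmetric for every $x\in\phi(\mathcal C_0)$. Let $\hat e_2>0$ be such that for every $x\in\phi(\mathcal C_0)$ there is an integer $k(x)\ge1$ for which, with $P_{\phi(\mathcal M_n)}$ the matrix of the orthogonal projection of $\mathbb R^{\bar n}$ onto $\phi(\mathcal M_n)$, $$D\hat F(x)+\hat e_2P_{\phi(\mathcal M_n)}=\operatorname{diag}(A_1,\dots,A_{2k(x)})$$ is block diagonal with square diagonal blocks $A_i$ (of positive sizes that may depend on $i$ and $x$), and $\{1,\dots,2k(x)\}$ is partitioned into $\{i_1,\dots,i_{k(x)}\}$ and $\{j_1,\dots,j_{k(x)}\}$ with $A_{i_l}=A_{j_l}$ for $1\le l\le k(x)$. Then for every $s\ge\hat e_2$ the monotonicity of $\mathcal F+N_{\mathcal C}$ is globally elicited at level $s$, i.e. the set-valued mapping $\mathcal F+N_{\mathcal C}+sP_{\mathcal M_n}:\mathcal L_n\rightrightarrows\mathcal L_n$ is maximal monotone, where $N_{\mathcal C}(x(\cdot))=\{v(\cdot):\langle v(\cdot),y(\cdot)-x(\cdot)\rangle\le0\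 \forall y(\cdot)\in\mathcal C\}$ for $x(\cdot)\in\mathcal C$ and $N_{\mathcal C}(x(\cdot))=\emptyset$ otherwise. -/

import Mathlib

universe u

noncomputable section

/-- The data of an `N`-stage decision problem with a finite product sample space
`Ξ 0 × ⋯ × Ξ (N-1)`: the dimension `n k` of the `k`-th decision vector, the finite support `Ξ k`
of the `k`-th random vector and the (strictly positive) probabilities of the scenarios. -/
structure MultistageModel (N : ℕ) where
  /-- dimension of the decision vector of each stage -/
  n : Fin N → ℕ
  /-- support of the random vector observed after each stage -/
  Ξ : Fin N → Type u
  [fintypeΞ : ∀ k, Fintype (Ξ k)]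
  /-- probability of a scenario -/
  p : (∀ k, Ξ k) → ℝ
  p_pos : ∀ ξ, 0 < p ξ
  p_sum : ∑ ξ, p ξ = 1

namespace MultistageModel

attribute [instance] MultistageModel.fintypeΞ

variable {N : ℕ} (S : MultistageModel.{u} N)

/-- Scenarios `ξ = (ξ₁, …, ξ_N)`. -/
abbrev Scenario : Type u := ∀ k, S.Ξ k

/-- The Euclidean space `ℝⁿ = ℝ^{n₁} × ⋯ × ℝ^{n_N}`; `v k` is the `k`-th stage component of `v`. -/
abbrev Decision : Type := PiLp 2 fun k : Fin N => EuclideanSpace ℝ (Fin (S.n k))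

/-- The space `𝓛_n` of all mappings `x(·)` from the scenarios to `ℝⁿ`. -/
def L : Type u := S.Scenario → S.Decision

instance : AddCommGroup S.L := inferInstanceAs (AddCommGroup (S.Scenario → S.Decision))

instance : Module ℝ S.L := inferInstanceAs (Module ℝ (S.Scenario → S.Decision))

instance : FiniteDimensional ℝ S.L :=
  inferInstanceAs (FiniteDimensional ℝ (S.Scenario → S.Decision))

/-- The inner product `⟨x(·), w(·)⟩ = ∑_ξ p(ξ) ∑_k ⟨x_k(ξ), w_k(ξ)⟩`. -/
@[reducible] def innerCore : InnerProductSpace.Core ℝ S.L where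
  inner x w := ∑ ξ : S.Scenario, S.p ξ * ∑ k, inner ℝ (x ξ k) (w ξ k)
  conj_inner_symm x w := by
    simp [real_inner_comm]
  re_inner_nonneg x := by
    refine Finset.sum_nonneg fun ξ _ => mul_nonneg (S.p_pos ξ).le ?_
    exact Finset.sum_nonneg fun k _ => real_inner_self_nonneg
  add_left x y w := by
    have h (ξ : S.Scenario) (k) : (x + y) ξ k = x ξ k + y ξ k := rfl
    simp only [h, inner_add_left, Finset.sum_add_distrib, mul_add]
  smul_left x w r := by
    have h (ξ : S.Scenario) (k) : (r • x) ξ k = r • x ξ k := rfl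
    simp only [h, real_inner_smul_left, ← Finset.mul_sum, conj_trivial]
    rw [Finset.mul_sum]
    exact Finset.sum_congr rfl fun ξ _ => by ring
  definite x h := by
    have h0 : ∀ ξ : S.Scenario, ∀ k, 0 ≤ inner ℝ (x ξ k) (x ξ k) :=
      fun _ _ => real_inner_self_nonneg
    funext ξ
    ext1 k
    have h1 := (Finset.sum_eq_zero_iff_of_nonneg (fun ξ _ =>
      mul_nonneg (S.p_pos ξ).le (Finset.sum_nonneg fun k _ => h0 ξ k))).1 h ξ (Finset.mem_univ _)
    have h2 := (mul_eq_zero.1 h1).resolve_left (S.p_pos ξ).ne'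
    have h3 := (Finset.sum_eq_zero_iff_of_nonneg (fun k _ => h0 ξ k)).1 h2 k (Finset.mem_univ _)
    exact inner_self_eq_zero.1 h3

instance : NormedAddCommGroup S.L := S.innerCore.toNormedAddCommGroup

instance : InnerProductSpace ℝ S.L := InnerProductSpace.ofCore S.innerCore.toCore

theorem inner_def (x w : S.L) :
    inner ℝ x w = ∑ ξ : S.Scenario, S.p ξ * ∑ k, inner ℝ (x ξ k) (w ξ k) := rfl

/-- The nonanticipativity subspace `𝓝_n`: `x_k(ξ)` does not depend on `ξ_k, …, ξ_N`. -/
def nonant : Submodule ℝ S.L where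
  carrier := {x | ∀ (k : Fin N) (ξ η : S.Scenario), (∀ j < k, ξ j = η j) → x ξ k = x η k}
  zero_mem' := fun _ _ _ _ => rfl
  add_mem' := fun hx hy k ξ η h =>
    congrArg₂ (fun a b : EuclideanSpace ℝ (Fin (S.n k)) => a + b) (hx k ξ η h) (hy k ξ η h)
  smul_mem' := fun c _ hx k ξ η h =>
    congrArg (fun a : EuclideanSpace ℝ (Fin (S.n k)) => c • a) (hx k ξ η h)

open Classical in
/-- The scenarios that share the history `(ξ₁, …, ξ_{k-1})` with `ξ`. -/
def sameHistory (k : Fin N) (ξ : S.Scenario) : Finset S.Scenario :=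
  {η | ∀ j < k, η j = ξ j}

/-- The conditional expectation `E_{ξ | ξ₁, …, ξ_{k-1}} w_k(ξ)`, as a function of `ξ`. -/
def condExpStage (k : Fin N) (w : S.L) (ξ : S.Scenario) : EuclideanSpace ℝ (Fin (S.n k)) :=
  (∑ η ∈ S.sameHistory k ξ, S.p η)⁻¹ • ∑ η ∈ S.sameHistory k ξ, S.p η • w η k

/-- The subspace `𝓜_n` of the `w(·)` with `E_{ξ | ξ₁, …, ξ_{k-1}} w_k(ξ) = 0` for all `k`. -/
def mult : Submodule ℝ S.L where
  carrier := {w | ∀ (k : Fin N) (ξ : S.Scenario), S.condExpStage k w ξ = 0}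
  zero_mem' := fun k ξ => by
    have h (η : S.Scenario) : (0 : S.L) η k = 0 := rfl
    simp [condExpStage, h]
  add_mem' := fun {x y} hx hy k ξ => by
    have h (η : S.Scenario) : (x + y) η k = x η k + y η k := rfl
    have hx' := hx k ξ
    have hy' := hy k ξ
    simp only [condExpStage] at hx' hy' ⊢
    simp only [h, smul_add, Finset.sum_add_distrib, hx', hy', add_zero]
  smul_mem' := fun c x hx k ξ => by
    have h (η : S.Scenario) : (c • x) η k = c • x η k := rfl
    have hx' := hx k ξ
    simp only [condExpStage] at hx' ⊢
    simp only [h, smul_comm _ c, ← Finset.smul_sum, hx', smul_zero]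

/-- `𝓜_n` is the orthogonal complement of `𝓝_n`. -/
theorem mult_eq_orthogonal : S.mult = S.nonantᗮ := by
  classical
  have hpos : ∀ (k : Fin N) (ξ : S.Scenario), (∑ η ∈ S.sameHistory k ξ, S.p η)⁻¹ ≠ 0 := by
    intro k ξ
    refine inv_ne_zero (ne_of_gt (Finset.sum_pos (fun η _ => S.p_pos η) ⟨ξ, ?_⟩))
    simp [sameHistory]
  ext w
  rw [Submodule.mem_orthogonal]
  constructor
  · intro hw x hx
    rw [inner_def]
    simp only [Finset.mul_sum]
    rw [Finset.sum_comm]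
    refine Finset.sum_eq_zero fun k _ => ?_
    let r : S.Scenario → (∀ j : {j : Fin N // j < k}, S.Ξ j) := fun ξ j => ξ j
    rw [← Finset.sum_fiberwise_of_maps_to (g := r) (t := Finset.univ.image r)
      (fun ξ h => Finset.mem_image_of_mem r h)]
    refine Finset.sum_eq_zero fun b hb => ?_
    obtain ⟨ξ, -, rfl⟩ := Finset.mem_image.1 hb
    have hfib : ({η | r η = r ξ} : Finset S.Scenario) = S.sameHistory k ξ := by
      ext η
      simp [sameHistory, r, funext_iff]
    have h0 : ∑ η ∈ S.sameHistory k ξ, S.p η • w η k = 0 :=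
      (smul_eq_zero.1 (hw k ξ)).resolve_left (hpos k ξ)
    calc _ = ∑ η ∈ S.sameHistory k ξ, inner ℝ (x ξ k) (S.p η • w η k) := by
            rw [← hfib]
            refine Finset.sum_congr rfl fun η hη => ?_
            rw [hfib] at hη
            have : x η k = x ξ k := hx k η ξ (by simpa [sameHistory] using hη)
            rw [this, real_inner_smul_right]
      _ = 0 := by rw [← inner_sum, h0, inner_zero_right]
  · intro hw k ξ
    have key : ∀ v : EuclideanSpace ℝ (Fin (S.n k)),
        inner ℝ v (∑ η ∈ S.sameHistory k ξ, S.p η • w η k) = 0 := by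
      intro v
      let x : S.L := fun η => WithLp.toLp 2 (Pi.single k (if η ∈ S.sameHistory k ξ then v else 0))
      have hx : x ∈ S.nonant := by
        intro l η η' h
        by_cases hl : l = k
        · subst hl
          have : η ∈ S.sameHistory l ξ ↔ η' ∈ S.sameHistory l ξ := by
            simp only [sameHistory, Finset.mem_filter, Finset.mem_univ, true_and]
            exact forall₂_congr fun j hj => by rw [h j hj]
          simp [x, this]
        · simp [x, hl]
      have h1 := hw x hx
      rw [inner_def] at h1
      rw [inner_sum, ← h1, ← Finset.sum_subset (Finset.subset_univ (S.sameHistory k ξ))]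
      · refine Finset.sum_congr rfl fun η hη => ?_
        rw [Finset.sum_eq_single k (fun l _ hl => by simp [x, hl]) (by simp), real_inner_smul_right]
        simp [x, hη]
      · intro η _ hη
        rw [Finset.sum_eq_zero (fun l _ => ?_), mul_zero]
        simp [x, hη]
    have h2 := inner_self_eq_zero.1 (key _)
    simp only [condExpStage, h2, smul_zero]

/-- The constraint set `𝓒 = {x(·) : x(ξ) ∈ C(ξ) for all ξ}`. -/
def constraintSet (C : S.Scenario → Set S.Decision) : Set S.L := {x | ∀ ξ, x ξ ∈ C ξ}

/-- The mapping `𝓕(x(·)) : ξ ↦ F(x(ξ), ξ)`. -/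
def nemytskii (F : S.Decision → S.Scenario → S.Decision) (x : S.L) : S.L := fun ξ => F (x ξ) ξ

/-- The number `J` of scenarios. -/
abbrev J : ℕ := Fintype.card S.Scenario

/-- The dimension `n̄ = J n`, where `n = ∑_k n_k`. -/
abbrev nbar : ℕ := S.J * ∑ k, S.n k

/-- Position in a vector of `ℝ^n̄` of the `a`-th coordinate of the `k`-th stage for the `i`-th
scenario: the scenario blocks follow one another, and so do the stages within each block. -/
def pos : Fin S.J × (Σ k : Fin N, Fin (S.n k)) ≃ Fin S.nbar :=
  (Equiv.prodCongr (Equiv.refl _) finSigmaFinEquiv).trans finProdFinEquiv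

/-- The `a`-th coordinate of the `k`-th stage component of `v`, for `c = (k, a)`. -/
def coord (v : S.Decision) (c : Σ k : Fin N, Fin (S.n k)) : ℝ := v c.1 c.2

/-- The linear map `φ : 𝓛_n → ℝ^n̄`, `x(·) ↦ (√p(ξ¹) x(ξ¹), …, √p(ξᴶ) x(ξᴶ))`, for the enumeration
`ξ¹, …, ξᴶ` of the scenarios given by `e`. -/
def phi (e : Fin S.J ≃ S.Scenario) : S.L →ₗ[ℝ] EuclideanSpace ℝ (Fin S.nbar) where
  toFun x := WithLp.toLp 2 fun m =>
    let q := S.pos.symm m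
    √(S.p (e q.1)) * S.coord (x (e q.1)) q.2
  map_add' x y := by
    ext m
    exact mul_add _ _ _
  map_smul' c x := by
    ext m
    exact mul_left_comm _ _ _

/-- The block `x_{p_i} ∈ ℝⁿ` of a vector `x = (x_{p_1}, …, x_{p_J}) ∈ ℝ^n̄`. -/
def scenarioBlock (x : EuclideanSpace ℝ (Fin S.nbar)) (i : Fin S.J) : S.Decision :=
  WithLp.toLp 2 fun k => WithLp.toLp 2 fun a => x (S.pos (i, ⟨k, a⟩))

/-- The mapping `F̂` on `ℝ^n̄` whose `i`-th block at `x` is `√p(ξⁱ) F(x_{p_i} / √p(ξⁱ), ξⁱ)`. -/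
def Fhat (e : Fin S.J ≃ S.Scenario) (F : S.Decision → S.Scenario → S.Decision)
    (x : EuclideanSpace ℝ (Fin S.nbar)) : EuclideanSpace ℝ (Fin S.nbar) :=
  WithLp.toLp 2 fun m =>
    let q := S.pos.symm m
    √(S.p (e q.1)) * S.coord (F ((1 / √(S.p (e q.1))) • S.scenarioBlock x q.1) (e q.1)) q.2

end MultistageModel

section HilbertSpace

variable {H : Type*} [NormedAddCommGroup H] [InnerProductSpace ℝ H]

/-- `F` is pseudomonotone on `K`. -/
def PseudomonotoneOn (F : H → H) (K : Set H) : Prop :=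
  ∀ x ∈ K, ∀ y ∈ K, 0 ≤ inner ℝ (y - x) (F x) → 0 ≤ inner ℝ (y - x) (F y)

/-- The normal cone mapping of a set `C`; it is empty off `C`. -/
def normalConeMap (C : Set H) (x : H) : Set H :=
  {v | x ∈ C ∧ ∀ y ∈ C, inner ℝ v (y - x) ≤ 0}

/-- The set-valued mapping `T` is monotone. -/
def IsMonotoneMap (T : H → Set H) : Prop :=
  ∀ x x' y y', y ∈ T x → y' ∈ T x' → 0 ≤ inner ℝ (y - y') (x - x')

/-- The set-valued mapping `T` is maximal monotone. -/
def IsMaximalMonotoneMap (T : H → Set H) : Prop :=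
  IsMonotoneMap T ∧
    ∀ x y, y ∉ T x → ∃ x' y', y' ∈ T x' ∧ inner ℝ (y - y') (x - x') < 0

/-- The monotonicity of `F + N_C` is elicited at level `s > 0`, where `M` is the complement of the
subspace with respect to which it is elicited: `F + N_C + s P_M` is (globally) maximal monotone. -/
def MonotonicityElicitedAt (F : H → H) (C : Set H) (M : Submodule ℝ H)
    [M.HasOrthogonalProjection] (s : ℝ) : Prop :=
  0 < s ∧ IsMaximalMonotoneMap fun x =>
    {y | ∃ v ∈ normalConeMap C x, y = F x + v + s • M.starProjection x}

end HilbertSpace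

/-- The matrix of an endomorphism of `ℝᵈ` in the standard basis. -/
def stdMatrix {d : ℕ} (T : EuclideanSpace ℝ (Fin d) →L[ℝ] EuclideanSpace ℝ (Fin d)) :
    Matrix (Fin d) (Fin d) ℝ :=
  Matrix.of fun i j => T (EuclideanSpace.single j 1) i

/-- The Jacobian matrix of `G` at `x`. -/
def jacobianMatrix {d : ℕ} (G : EuclideanSpace ℝ (Fin d) → EuclideanSpace ℝ (Fin d))
    (x : EuclideanSpace ℝ (Fin d)) : Matrix (Fin d) (Fin d) ℝ :=
  stdMatrix (fderiv ℝ G x)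

/-- `B = diag(A₁, …, A_{2k})` is block diagonal with `k ≥ 1` pairs of same blocks: the indices of
the blocks are partitioned into `{σ 0, …, σ (k-1)}` and `{τ 0, …, τ (k-1)}` such that the blocks
number `σ l` and `τ l` are the same matrix, for all `l`. -/
def IsPairedBlockDiagonal {d : ℕ} (B : Matrix (Fin d) (Fin d) ℝ) : Prop :=
  ∃ (k : ℕ) (m : Fin (2 * k) → ℕ) (hm : ∑ i, m i = d)
    (A : ∀ i, Matrix (Fin (m i)) (Fin (m i)) ℝ) (σ τ : Fin k → Fin (2 * k)),
    1 ≤ k ∧ (∀ i, 0 < m i) ∧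
    B = Matrix.reindex (finSigmaFinEquiv.trans (finCongr hm))
      (finSigmaFinEquiv.trans (finCongr hm)) (Matrix.blockDiagonal' A) ∧
    Function.Bijective (Sum.elim σ τ) ∧
    ∀ l, ∃ h : m (σ l) = m (τ l),
      A (τ l) = Matrix.reindex (finCongr h) (finCongr h) (A (σ l))

end

/-! Differentiating the pseudomonotonicity inequality along a line shows that $D\mathcal F(x)$ is
positive semidefinite on the hyperplane orthogonal to $\mathcal F(x)$. Adding $\hat e_2P_{\mathcal
M_n}$ keeps this, so after transport by the isometry $\phi$ the matrix $B=D\hat F+\hat e_2P$ can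
fail to be positive only off one hyperplane. The pairing of blocks rules that failure out: copies
$au$ and $bu$ of a vector $u$ in two equal blocks give the quadratic form the value
$(a^2+b^2)\langle u,A_iu\rangle$, and some $(a,b)\ne0$ puts the combination in the hyperplane. Hence
every block, and so $B$, is positive semidefinite
(`IsPairedBlockDiagonal.nonneg_of_nonneg_on_hyperplane`).

Thus $G=\mathcal F+sP_{\mathcal M_n}$ is monotone on $\mathcal C_0$ for $s\ge\hat e_2$. Maximality
of $G+N_{\mathcal C}$ follows by Minty's argument from the solvability of $z\in x+G(x)+N_{\mathcal
C}(x)$ for every $z$, which `exists_resolvent_of_contDiffOn` obtains from a projected Banach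
iteration on a compact truncation of $\mathcal C$. -/

section VariationalInequality

/-! ### Derivatives of pseudomonotone and monotone maps. -/

variable {H : Type*} [NormedAddCommGroup H] [InnerProductSpace ℝ H]

/-- If `F` is pseudomonotone on a neighbourhood of `x`, its derivative at `x` is positive
semidefinite on the orthogonal complement of `F x`. -/
theorem PseudomonotoneOn.inner_deriv_nonneg {F : H → H} {K : Set H} (hF : PseudomonotoneOn F K)
    (hK : IsOpen K) {x : H} (hx : x ∈ K) {F' : H →L[ℝ] H} (hF' : HasFDerivAt F F' x) {h : H}
    (hh : inner ℝ h (F x) = 0) : 0 ≤ inner ℝ h (F' h) := by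
  have hline : HasDerivAt (fun t : ℝ => x + t • h) h 0 := by
    simpa using ((hasDerivAt_id (0 : ℝ)).smul_const h).const_add x
  have hg : HasDerivAt (fun t : ℝ => inner ℝ h (F (x + t • h))) (inner ℝ h (F' h)) 0 := by
    have h1 : HasDerivAt (fun t : ℝ => F (x + t • h)) (F' h) 0 :=
      HasFDerivAt.comp_hasDerivAt (0 : ℝ) (by simpa using hF') hline
    simpa using (hasDerivAt_const (0 : ℝ) h).inner ℝ h1
  have hmem : ∀ᶠ t : ℝ in nhds 0, x + t • h ∈ K :=
    hline.continuousAt.eventually_mem (hK.mem_nhds (by simpa using hx))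
  have hslope := hasDerivAt_iff_tendsto_slope.1 hg
  refine ge_of_tendsto (hslope.mono_left (nhdsWithin_mono 0 (s := Set.Ioi 0) fun t ht => ne_of_gt ht)) ?_
  filter_upwards [nhdsWithin_le_nhds hmem, self_mem_nhdsWithin] with t ht (ht0 : 0 < t)
  -- The premise of pseudomonotonicity for the pair $x$, $x+th$ holds with equality; its conclusion,
  -- divided by $t>0$, makes the right-hand difference quotients nonnegative.
  have h2 := hF x hx _ ht (by simp [real_inner_smul_left, hh])
  rw [add_sub_cancel_left, real_inner_smul_left] at h2
  have h3 := nonneg_of_mul_nonneg_right h2 ht0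
  simp only [slope_def_field, zero_smul, add_zero, hh, sub_zero]
  positivity

/-- A map with positive semidefinite derivative on a convex set is monotone there. -/
theorem inner_sub_nonneg_of_deriv_nonneg {G : H → H} {G' : H → H →L[ℝ] H} {K : Set H}
    (hK : Convex ℝ K) (hG : ∀ x ∈ K, HasFDerivAt G (G' x) x)
    (hpos : ∀ x ∈ K, ∀ h, 0 ≤ inner ℝ h (G' x h)) {x y : H} (hx : x ∈ K) (hy : y ∈ K) :
    0 ≤ inner ℝ (G y - G x) (y - x) := by
  set h := y - x with hh
  have hmem : ∀ t ∈ Set.Icc (0 : ℝ) 1, x + t • h ∈ K := fun t ht =>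
    hK.add_smul_sub_mem hx hy ht
  have hline (t : ℝ) : HasDerivAt (fun t : ℝ => x + t • h) h t := by
    simpa using ((hasDerivAt_id t).smul_const h).const_add x
  have hd : ∀ t ∈ Set.Icc (0 : ℝ) 1,
      HasDerivAt (fun t : ℝ => inner ℝ h (G (x + t • h))) (inner ℝ h (G' (x + t • h) h)) t := by
    intro t ht
    have h1 : HasDerivAt (fun t : ℝ => G (x + t • h)) (G' (x + t • h) h) t :=
      HasFDerivAt.comp_hasDerivAt t (hG _ (hmem t ht)) (hline t)
    simpa using (hasDerivAt_const t h).inner ℝ h1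
  have hmono := monotoneOn_of_deriv_nonneg (convex_Icc (0 : ℝ) 1)
    (fun t ht => (hd t ht).continuousAt.continuousWithinAt)
    (fun t ht => (hd t (interior_subset ht)).differentiableAt.differentiableWithinAt)
    (fun t ht => by
      rw [(hd t (interior_subset ht)).deriv]
      exact hpos _ (hmem t (interior_subset ht)) h)
  have h01 := hmono (Set.left_mem_Icc.2 zero_le_one) (Set.right_mem_Icc.2 zero_le_one) zero_le_one
  simp only [zero_smul, add_zero, one_smul, hh, add_sub_cancel] at h01
  rw [real_inner_comm, inner_sub_right]
  linarith

/-! ### Solvability of variational inequalities and Minty's criterion. -/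

/-- Nearest point map onto a complete convex set. -/
theorem exists_metricProjection {K : Set H} (hne : K.Nonempty) (hK : IsComplete K)
    (hconv : Convex ℝ K) :
    ∃ P : H → H, ∀ x, P x ∈ K ∧ ∀ w ∈ K, inner ℝ (x - P x) (w - P x) ≤ 0 := by
  choose P hP using exists_norm_eq_iInf_of_complete_convex hne hK hconv
  exact ⟨P, fun x => ⟨(hP x).1, (norm_eq_iInf_iff_real_inner_le_zero hconv (hP x).1).1 (hP x).2⟩⟩

/-- Existence of a solution of the variational inequality of a strongly monotone Lipschitz map. -/
theorem exists_variationalInequality_of_lipschitzOnWith {A : H → H} {K : Set H}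
    (hne : K.Nonempty) (hK : IsComplete K) (hconv : Convex ℝ K) {L : NNReal}
    (hL : LipschitzOnWith L A K)
    (hA : ∀ x ∈ K, ∀ y ∈ K, ‖x - y‖ ^ 2 ≤ inner ℝ (A x - A y) (x - y)) :
    ∃ x ∈ K, ∀ u ∈ K, 0 ≤ inner ℝ (A x) (u - x) := by
  obtain ⟨P, hP⟩ := exists_metricProjection hne hK hconv
  have hPlip (a b : H) : ‖P a - P b‖ ≤ ‖a - b‖ := by
    have h1 := (hP a).2 _ (hP b).1
    have h2 := (hP b).2 _ (hP a).1
    have h3 : ‖P a - P b‖ ^ 2 ≤ inner ℝ (a - b) (P a - P b) := by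
      rw [← real_inner_self_eq_norm_sq]
      simp only [inner_sub_left, inner_sub_right] at h1 h2 ⊢
      linarith
    have h4 := real_inner_le_norm (a - b) (P a - P b)
    by_contra! h5
    nlinarith [norm_nonneg (a - b)]
  -- The step $t=1/M^2$ minimises the squared contraction factor $1-2t+t^2M^2$, with value $1-t$.
  -- Enlarging $L$ to $M\ge1$ ensures $t\le1$, so that the square root is meaningful.
  set M : ℝ := L + 1
  have hM1 : 1 ≤ M := by simp [M]
  set t : ℝ := 1 / M ^ 2
  have ht : 0 < t := by positivity
  have hts : t * M ^ 2 = 1 := by simp only [t]; field_simp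
  have ht1 : t ≤ 1 := div_le_one_of_le₀ (one_le_pow₀ hM1) (by positivity)
  have hstep : ∀ x ∈ K, ∀ y ∈ K,
      ‖(x - t • A x) - (y - t • A y)‖ ≤ √(1 - t) * ‖x - y‖ := by
    intro x hx y hy
    have hl : ‖A x - A y‖ ≤ M * ‖x - y‖ := by
      have := lipschitzOnWith_iff_norm_sub_le.1 hL hx hy
      nlinarith [norm_nonneg (x - y)]
    have hl2 : ‖A x - A y‖ ^ 2 ≤ M ^ 2 * ‖x - y‖ ^ 2 := by
      rw [← mul_pow]
      gcongr
    have hm := hA x hx y hy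
    rw [← Real.sqrt_sq (norm_nonneg (x - y)), ← Real.sqrt_mul (by linarith)]
    refine Real.le_sqrt_of_sq_le ?_
    have : (x - t • A x) - (y - t • A y) = (x - y) - t • (A x - A y) := by
      rw [smul_sub]; abel
    rw [this, norm_sub_sq_real, norm_smul, real_inner_smul_right, Real.norm_of_nonneg ht.le,
      mul_pow, real_inner_comm]
    have e1 : t * ‖x - y‖ ^ 2 ≤ t * inner ℝ (A x - A y) (x - y) := by gcongr
    have e2 : t ^ 2 * ‖A x - A y‖ ^ 2 ≤ t ^ 2 * (M ^ 2 * ‖x - y‖ ^ 2) := by gcongr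
    have e3 : t ^ 2 * (M ^ 2 * ‖x - y‖ ^ 2) = t * ‖x - y‖ ^ 2 := by
      linear_combination (t * ‖x - y‖ ^ 2) * hts
    linarith
  set T : H → H := fun x => P (x - t • A x)
  have hmaps : Set.MapsTo T K K := fun x _ => (hP _).1
  have hq : √(1 - t) < 1 := by
    rw [Real.sqrt_lt' one_pos]; linarith
  have hcontr : ContractingWith (√(1 - t)).toNNReal (hmaps.restrict T K K) := by
    refine ⟨by simpa using hq, LipschitzWith.of_dist_le_mul fun x y => ?_⟩
    rw [Real.coe_toNNReal _ (Real.sqrt_nonneg _), Subtype.dist_eq, Subtype.dist_eq, dist_eq_norm,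
      dist_eq_norm]
    exact (hPlip _ _).trans (hstep x x.2 y y.2)
  obtain ⟨x₀, hx₀⟩ := hne
  obtain ⟨x, hx, hfix, -⟩ := hcontr.exists_fixedPoint' hK hmaps hx₀ (edist_ne_top _ _)
  refine ⟨x, hx, fun u hu => ?_⟩
  have h1 := (hP (x - t • A x)).2 u hu
  have h2 : P (x - t • A x) = x := hfix
  rw [h2, sub_sub_cancel_left, inner_neg_left, real_inner_smul_left] at h1
  nlinarith

/-- Minty: if `id + G` solves every variational inequality over `C` and `G` is monotone on `C`,
then `G + N_C` is maximal monotone. -/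
theorem isMaximalMonotoneMap_add_normalConeMap {G : H → H} {C : Set H}
    (hG : ∀ x ∈ C, ∀ y ∈ C, 0 ≤ inner ℝ (G x - G y) (x - y))
    (hsol : ∀ z, ∃ x ∈ C, ∀ u ∈ C, 0 ≤ inner ℝ (x + G x - z) (u - x)) :
    IsMaximalMonotoneMap fun x => {y | ∃ v ∈ normalConeMap C x, y = G x + v} := by
  constructor
  · rintro x x' _ _ ⟨v, ⟨hx, hv⟩, rfl⟩ ⟨v', ⟨hx', hv'⟩, rfl⟩
    have h1 := hG x hx x' hx'
    have h2 := hv x' hx'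
    have h3 := hv' x hx
    simp only [inner_sub_left, inner_sub_right, inner_add_left] at h1 h2 h3 ⊢
    linarith
  · intro x y hxy
    -- Solving at $z=x+y$ gives $y'=x+y-x'$ in the image of $x'$, with $y-y'=-(x-x')$. The inner
    -- product to be made negative is then $-\|x-x'\|^2$, and $x=x'$ would force $y=y'$, contrary to
    -- the choice of $y$.
    obtain ⟨x', hx', hvi⟩ := hsol (x + y)
    have hmem : ∃ v ∈ normalConeMap C x', x + y - x' = G x' + v := by
      refine ⟨x + y - x' - G x', ⟨hx', fun u hu => ?_⟩, by abel⟩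
      have h := hvi u hu
      rw [← neg_nonneg, ← inner_neg_left]
      convert h using 2
      abel
    refine ⟨x', x + y - x', hmem, ?_⟩
    have hne : x - x' ≠ 0 := by
      intro h0
      obtain rfl := sub_eq_zero.1 h0
      apply hxy
      rwa [add_sub_cancel_left] at hmem
    have : y - (x + y - x') = -(x - x') := by abel
    rw [this, inner_neg_left, neg_lt_zero]
    exact real_inner_self_pos.2 hne

/-- Existence of solutions of `0 ∈ x + G x - z + N_C x` for a continuously differentiable monotone
map `G` in finite dimension. -/
theorem exists_resolvent_of_contDiffOn [FiniteDimensional ℝ H] {G : H → H} {C C₀ : Set H}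
    (hne : C.Nonempty) (hclosed : IsClosed C) (hconv : Convex ℝ C) (hopen : IsOpen C₀)
    (hCC₀ : C ⊆ C₀) (hdiff : ContDiffOn ℝ 1 G C₀)
    (hG : ∀ x ∈ C, ∀ y ∈ C, 0 ≤ inner ℝ (G x - G y) (x - y)) (z : H) :
    ∃ x ∈ C, ∀ u ∈ C, 0 ≤ inner ℝ (x + G x - z) (u - x) := by
  have : ProperSpace H := FiniteDimensional.proper ℝ H
  obtain ⟨u₀, hu₀⟩ := hne
  set r := ‖z - u₀ - G u₀‖
  -- Compactness makes the $C^1$ map Lipschitz. The radius exceeds the a priori bound $r$ by one, so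
  -- the ball constraint is inactive at the solution.
  set K := C ∩ Metric.closedBall u₀ (r + 1)
  have hKcomp : IsCompact K := (isCompact_closedBall _ _).inter_left hclosed
  have hKconv : Convex ℝ K := hconv.inter (convex_closedBall _ _)
  have hr : 0 ≤ r := norm_nonneg _
  have hu₀K : u₀ ∈ K := ⟨hu₀, Metric.mem_closedBall_self (by positivity)⟩
  set A : H → H := fun x => x + G x - z
  have hAdiff : ContDiffOn ℝ 1 A C₀ := (contDiffOn_id.add hdiff).sub contDiffOn_const
  have hAloc : LocallyLipschitzOn K A := by
    intro x hx
    obtain ⟨L, t, ht, hL⟩ :=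
      (hAdiff.contDiffAt (hopen.mem_nhds (hCC₀ hx.1))).exists_lipschitzOnWith
    exact ⟨L, t, mem_nhdsWithin_of_mem_nhds ht, hL⟩
  obtain ⟨L, hL⟩ := hAloc.exists_lipschitzOnWith_of_compact hKcomp
  have hA : ∀ x ∈ C, ∀ y ∈ C, ‖x - y‖ ^ 2 ≤ inner ℝ (A x - A y) (x - y) := by
    intro x hx y hy
    have h := hG x hx y hy
    have : A x - A y = (x - y) + (G x - G y) := by simp only [A]; abel
    rw [this, inner_add_left, real_inner_self_eq_norm_sq]
    linarith
  obtain ⟨x, hx, hvi⟩ := exists_variationalInequality_of_lipschitzOnWith ⟨u₀, hu₀K⟩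
    hKcomp.isComplete hKconv hL fun x hx y hy => hA x hx.1 y hy.1
  -- Strong monotonicity between $x$ and $u_0$, with the inequality tested at $u_0$, gives
  -- $\|x-u_0\|^2\le\langle -A(u_0),x-u_0\rangle\le r\|x-u_0\|$.
  have hxr : ‖x - u₀‖ ≤ r := by
    have h1 := hA x hx.1 u₀ hu₀
    have h2 := hvi u₀ hu₀K
    have h3 : inner ℝ (A x) (u₀ - x) = - inner ℝ (A x) (x - u₀) := by
      rw [← inner_neg_right, neg_sub]
    have h4 : A u₀ = -(z - u₀ - G u₀) := by simp only [A]; abel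
    have h5 := real_inner_le_norm (z - u₀ - G u₀) (x - u₀)
    rw [inner_sub_left, h4, inner_neg_left] at h1
    by_contra! h6
    nlinarith [norm_nonneg (x - u₀)]
  refine ⟨x, hx.1, fun u hu => ?_⟩
  -- The displacement $t(u-x)$ has length below one, so it stays in the larger ball; dividing by $t$
  -- extends the inequality from $K$ to all of $C$.
  set t : ℝ := 1 / (1 + ‖u - x‖)
  have ht : 0 < t := by positivity
  have ht1 : t * (1 + ‖u - x‖) = 1 := by simp only [t]; field_simp
  have hmem : x + t • (u - x) ∈ K := by
    refine ⟨hconv.add_smul_sub_mem hx.1 hu ⟨ht.le, by nlinarith [norm_nonneg (u - x)]⟩, ?_⟩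
    rw [mem_closedBall_iff_norm, add_sub_right_comm]
    refine (norm_add_le _ _).trans (add_le_add hxr ?_)
    rw [norm_smul, Real.norm_of_nonneg ht.le]
    linarith
  have h := hvi _ hmem
  rw [add_sub_cancel_left, real_inner_smul_right] at h
  exact nonneg_of_mul_nonneg_right h ht

end VariationalInequality

/-! ### Positivity of block diagonal matrices with repeated blocks. -/

section PairedBlocks

open Matrix

theorem dotProduct_blockDiagonal'_mulVec {ι : Type*} [Fintype ι] [DecidableEq ι] {m : ι → Type*}
    [∀ i, Fintype (m i)] (A : ∀ i, Matrix (m i) (m i) ℝ) (g h : ∀ i, m i → ℝ) :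
    (fun q : Σ i, m i => g q.1 q.2) ⬝ᵥ (blockDiagonal' A *ᵥ fun q => h q.1 q.2) =
      ∑ i, g i ⬝ᵥ (A i *ᵥ h i) := by
  simp only [dotProduct, mulVec, Fintype.sum_sigma]
  refine Finset.sum_congr rfl fun i _ => Finset.sum_congr rfl fun a _ => ?_
  congr 1
  rw [Finset.sum_eq_single i]
  · simp [blockDiagonal'_apply_eq]
  · intro j _ hj
    exact Finset.sum_eq_zero fun b _ => by rw [blockDiagonal'_apply_ne _ _ _ hj.symm, zero_mul]
  · simp

/-- If two of the blocks of a block diagonal matrix agree and the matrix is positive semidefinite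
on a hyperplane, then this block is positive semidefinite. -/
theorem block_nonneg_of_nonneg_on_hyperplane {ι : Type*} [Fintype ι] [DecidableEq ι]
    {m : ι → Type*} [∀ i, Fintype (m i)] {A : ∀ i, Matrix (m i) (m i) ℝ}
    {w : (Σ i, m i) → ℝ}
    (hw : ∀ h : (Σ i, m i) → ℝ, h ⬝ᵥ w = 0 → 0 ≤ h ⬝ᵥ (blockDiagonal' A *ᵥ h))
    {i j : ι} (hij : i ≠ j) (c : m i ≃ m j) (hc : A j = Matrix.reindex c c (A i))
    (u : m i → ℝ) : 0 ≤ u ⬝ᵥ (A i *ᵥ u) := by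
  set u' : m j → ℝ := u ∘ c.symm
  have hu' : u' ⬝ᵥ (A j *ᵥ u') = u ⬝ᵥ (A i *ᵥ u) := by
    rw [hc, reindex_apply, submatrix_mulVec_equiv]
    simp [u', Function.comp_assoc]
  -- The test vector carries $au$ in block $i$, the corresponding $bu'$ in block $j$, and zero
  -- elsewhere; there are no cross terms between blocks.
  let g (a b : ℝ) : ∀ k, m k → ℝ :=
    Function.update (Function.update (fun _ => 0) i (a • u)) j (b • u')
  have hgi (a b : ℝ) : g a b i = a • u := by
    simp [g, Function.update_of_ne hij]
  have hgj (a b : ℝ) : g a b j = b • u' := by simp [g]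
  have hgk (a b : ℝ) {k : ι} (hi : k ≠ i) (hj : k ≠ j) : g a b k = 0 := by
    simp [g, Function.update_of_ne hi, Function.update_of_ne hj]
  have hquad (a b : ℝ) : (fun q : Σ i, m i => g a b q.1 q.2) ⬝ᵥ
      (blockDiagonal' A *ᵥ fun q => g a b q.1 q.2) = (a ^ 2 + b ^ 2) * (u ⬝ᵥ (A i *ᵥ u)) := by
    rw [dotProduct_blockDiagonal'_mulVec, Fintype.sum_eq_add i j hij, hgi, hgj]
    · simp only [mulVec_smul, smul_dotProduct, dotProduct_smul, hu', smul_eq_mul]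
      ring
    · rintro k ⟨hi, hj⟩
      simp [hgk a b hi hj]
  have hlin (a b : ℝ) : (fun q : Σ i, m i => g a b q.1 q.2) ⬝ᵥ w =
      a * (u ⬝ᵥ fun x => w ⟨i, x⟩) + b * (u' ⬝ᵥ fun x => w ⟨j, x⟩) := by
    have : (fun q : Σ i, m i => g a b q.1 q.2) ⬝ᵥ w =
        ∑ k, g a b k ⬝ᵥ fun x => w ⟨k, x⟩ := by
      simp only [dotProduct, Fintype.sum_sigma]
    rw [this, Fintype.sum_eq_add i j hij, hgi, hgj]
    · simp only [smul_dotProduct, smul_eq_mul]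
    · rintro k ⟨hi, hj⟩
      simp [hgk a b hi hj]
  -- One linear equation in two unknowns has a nonzero solution.
  obtain ⟨a, b, hab, hpos⟩ : ∃ a b : ℝ, a * (u ⬝ᵥ fun x => w ⟨i, x⟩) +
      b * (u' ⬝ᵥ fun x => w ⟨j, x⟩) = 0 ∧ 0 < a ^ 2 + b ^ 2 := by
    by_cases h0 : (u ⬝ᵥ fun x => w ⟨i, x⟩) = 0
    · exact ⟨1, 0, by simp [h0], by norm_num⟩
    · exact ⟨u' ⬝ᵥ fun x => w ⟨j, x⟩, -(u ⬝ᵥ fun x => w ⟨i, x⟩), by ring,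
        by have := sq_pos_of_ne_zero h0; nlinarith [sq_nonneg (u' ⬝ᵥ fun x => w ⟨j, x⟩)]⟩
  have h := hw _ ((hlin a b).trans hab)
  rw [hquad] at h
  exact nonneg_of_mul_nonneg_right h hpos

/-- A block diagonal matrix with paired blocks that is positive semidefinite on a hyperplane is
positive semidefinite. -/
theorem IsPairedBlockDiagonal.nonneg_of_nonneg_on_hyperplane {d : ℕ} {B : Matrix (Fin d) (Fin d) ℝ}
    (hB : IsPairedBlockDiagonal B) {w : Fin d → ℝ}
    (hw : ∀ h : Fin d → ℝ, h ⬝ᵥ w = 0 → 0 ≤ h ⬝ᵥ (B *ᵥ h)) (h : Fin d → ℝ) :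
    0 ≤ h ⬝ᵥ (B *ᵥ h) := by
  obtain ⟨k, m, hm, A, σ, τ, -, -, rfl, hbij, hpair⟩ := hB
  set E := finSigmaFinEquiv.trans (finCongr hm)
  have hE (h : Fin d → ℝ) : h ⬝ᵥ (reindex E E (blockDiagonal' A) *ᵥ h) =
      (h ∘ E) ⬝ᵥ (blockDiagonal' A *ᵥ (h ∘ E)) := by
    rw [reindex_apply, submatrix_mulVec_equiv, Equiv.symm_symm, dotProduct_comp_equiv_symm]
  have hw' : ∀ h : (Σ i, Fin (m i)) → ℝ, h ⬝ᵥ (w ∘ E) = 0 →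
      0 ≤ h ⬝ᵥ (blockDiagonal' A *ᵥ h) := by
    intro h hh
    have := hw (h ∘ E.symm) (by rwa [comp_equiv_symm_dotProduct])
    rwa [hE, Function.comp_assoc, E.symm_comp_self, Function.comp_id] at this
  have hne (l : Fin k) : σ l ≠ τ l := fun h0 => by
    simpa using hbij.1 (a₁ := Sum.inl l) (a₂ := Sum.inr l) h0
  have hblocks : ∀ i (u : Fin (m i) → ℝ), 0 ≤ u ⬝ᵥ (A i *ᵥ u) := by
    intro i
    obtain ⟨l | l, rfl⟩ := hbij.2 i
    · obtain ⟨hl, hA⟩ := hpair l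
      exact block_nonneg_of_nonneg_on_hyperplane hw' (hne l) (finCongr hl) hA
    · obtain ⟨hl, hA⟩ := hpair l
      refine block_nonneg_of_nonneg_on_hyperplane hw' (hne l).symm (finCongr hl.symm) ?_
      change A (σ l) = reindex (finCongr hl.symm) (finCongr hl.symm) (A (τ l))
      rw [hA]
      rfl
  rw [hE]
  have := dotProduct_blockDiagonal'_mulVec A (fun i a => h (E ⟨i, a⟩)) fun i a => h (E ⟨i, a⟩)
  refine (Finset.sum_nonneg fun i _ => hblocks i _).trans_eq this.symm

theorem dotProduct_stdMatrix_mulVec {d : ℕ}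
    (T : EuclideanSpace ℝ (Fin d) →L[ℝ] EuclideanSpace ℝ (Fin d))
    (v : EuclideanSpace ℝ (Fin d)) :
    v.ofLp ⬝ᵥ (stdMatrix T *ᵥ v.ofLp) = inner ℝ v (T v) := by
  have h : stdMatrix T *ᵥ v.ofLp = (T v).ofLp := by
    conv_rhs => rw [← (EuclideanSpace.basisFun (Fin d) ℝ).sum_repr v]
    ext i
    simp [stdMatrix, mulVec, dotProduct, mul_comm]
  rw [h, EuclideanSpace.inner_eq_star_dotProduct, dotProduct_comm]
  simp

end PairedBlocks

/-! ### Transport between $\mathcal L_n$ and $\mathbb R^{\bar n}$ along $\phi$. -/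

namespace MultistageModel

variable {N : ℕ} (S : MultistageModel.{u} N)

theorem phi_apply_pos (e : Fin S.J ≃ S.Scenario) (x : S.L)
    (q : Fin S.J × Σ k : Fin N, Fin (S.n k)) :
    S.phi e x (S.pos q) = √(S.p (e q.1)) * x (e q.1) q.2.1 q.2.2 := by
  change (fun q : Fin S.J × Σ k : Fin N, Fin (S.n k) =>
    √(S.p (e q.1)) * S.coord (x (e q.1)) q.2) (S.pos.symm (S.pos q)) = _
  rw [Equiv.symm_apply_apply]
  rfl

theorem inner_phi (e : Fin S.J ≃ S.Scenario) (x w : S.L) :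
    inner ℝ (S.phi e x) (S.phi e w) = inner ℝ x w := by
  rw [PiLp.inner_apply, inner_def, ← e.sum_comp, ← S.pos.sum_comp, Fintype.sum_prod_type]
  refine Finset.sum_congr rfl fun i _ => ?_
  rw [Fintype.sum_sigma, Finset.mul_sum]
  refine Finset.sum_congr rfl fun k _ => ?_
  rw [PiLp.inner_apply, Finset.mul_sum]
  refine Finset.sum_congr rfl fun a _ => ?_
  simp only [phi_apply_pos, RCLike.inner_apply, conj_trivial]
  linear_combination (x (e i) k a * w (e i) k a) * Real.mul_self_sqrt (S.p_pos (e i)).le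

theorem phi_surjective (e : Fin S.J ≃ S.Scenario) : Function.Surjective (S.phi e) := by
  intro y
  let x : S.L := fun ξ => (1 / √(S.p ξ)) • S.scenarioBlock y (e.symm ξ)
  refine ⟨x, ?_⟩
  ext m
  obtain ⟨⟨i, k, a⟩, rfl⟩ := S.pos.surjective m
  have hp : √(S.p (e i)) ≠ 0 := (Real.sqrt_pos.2 (S.p_pos _)).ne'
  rw [phi_apply_pos]
  simp [x, scenarioBlock, hp]

/-- The isometry `φ` of `𝓛_n` onto `ℝ^n̄`. -/
noncomputable def phiIsometry (e : Fin S.J ≃ S.Scenario) : S.L ≃ₗᵢ[ℝ] EuclideanSpace ℝ (Fin S.nbar) :=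
  LinearIsometryEquiv.ofSurjective ((S.phi e).isometryOfInner (S.inner_phi e)) (S.phi_surjective e)

theorem phiIsometry_apply (e : Fin S.J ≃ S.Scenario) (x : S.L) :
    S.phiIsometry e x = S.phi e x := rfl

/-- The factors $1/\sqrt{p}$ inside $\hat F$ undo the weights of $\phi$, so $\hat F$ is $\mathcal F$
conjugated by $\phi$. -/
theorem Fhat_phi (e : Fin S.J ≃ S.Scenario) (F : S.Decision → S.Scenario → S.Decision) (x : S.L) :
    S.Fhat e F (S.phi e x) = S.phi e (S.nemytskii F x) := by
  have h (i : Fin S.J) : (1 / √(S.p (e i))) • S.scenarioBlock (S.phi e x) i = x (e i) := by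
    have hp : √(S.p (e i)) ≠ 0 := (Real.sqrt_pos.2 (S.p_pos _)).ne'
    ext k a
    simp [phi_apply_pos, scenarioBlock, hp]
  ext m
  simp only [Fhat, h]
  rfl

theorem Fhat_eq_comp (e : Fin S.J ≃ S.Scenario) (F : S.Decision → S.Scenario → S.Decision) :
    S.Fhat e F = fun y => S.phiIsometry e (S.nemytskii F ((S.phiIsometry e).symm y)) := by
  funext y
  obtain ⟨x, rfl⟩ := (S.phiIsometry e).surjective y
  rw [LinearIsometryEquiv.symm_apply_apply, phiIsometry_apply, phiIsometry_apply, Fhat_phi]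

theorem fderiv_Fhat_phi (e : Fin S.J ≃ S.Scenario) (F : S.Decision → S.Scenario → S.Decision)
    {x : S.L} (hF : DifferentiableAt ℝ (S.nemytskii F) x) (h : S.L) :
    fderiv ℝ (S.Fhat e F) (S.phi e x) (S.phi e h) =
      S.phi e (fderiv ℝ (S.nemytskii F) x h) := by
  set Φ := S.phiIsometry e
  have hF' : HasFDerivAt (S.nemytskii F) (fderiv ℝ (S.nemytskii F) x) (Φ.symm (Φ x)) := by
    rw [Φ.symm_apply_apply]
    exact hF.hasFDerivAt
  have hΦ (z : S.L) : HasFDerivAt Φ Φ.toContinuousLinearEquiv.toContinuousLinearMap z :=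
    Φ.toContinuousLinearEquiv.hasFDerivAt
  have hΦs : HasFDerivAt Φ.symm Φ.symm.toContinuousLinearEquiv.toContinuousLinearMap (Φ x) :=
    Φ.symm.toContinuousLinearEquiv.hasFDerivAt
  have h1 := (hΦ _).comp (Φ x) (hF'.comp (Φ x) hΦs)
  have h2 : S.Fhat e F = Φ ∘ S.nemytskii F ∘ Φ.symm := S.Fhat_eq_comp e F
  rw [← h2] at h1
  rw [← phiIsometry_apply, h1.fderiv]
  change Φ (fderiv ℝ (S.nemytskii F) x (Φ.symm (Φ h))) = _
  rw [Φ.symm_apply_apply]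
  rfl

theorem starProjection_map_phi (e : Fin S.J ≃ S.Scenario) (M : Submodule ℝ S.L) (h : S.L) :
    (M.map (S.phi e)).starProjection (S.phi e h) = S.phi e (M.starProjection h) :=
  (((S.phi e).isometryOfInner (S.inner_phi e)).map_starProjection M h).symm

/-- Since $\phi$ is an isometry that conjugates both the derivative and the projection, the matrix
hypothesis becomes a statement about quadratic forms on $\mathcal L_n$. -/
theorem dotProduct_jacobianMatrix_add_projection (e : Fin S.J ≃ S.Scenario)
    (F : S.Decision → S.Scenario → S.Decision) {x : S.L}
    (hF : DifferentiableAt ℝ (S.nemytskii F) x) (M : Submodule ℝ S.L) (c : ℝ) (h : S.L) :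
    (S.phi e h).ofLp ⬝ᵥ (jacobianMatrix (S.Fhat e F) (S.phi e x) +
        c • stdMatrix (M.map (S.phi e)).starProjection).mulVec (S.phi e h).ofLp =
      inner ℝ h (fderiv ℝ (S.nemytskii F) x h) + c * inner ℝ h (M.starProjection h) := by
  rw [Matrix.add_mulVec, Matrix.smul_mulVec, dotProduct_add, dotProduct_smul, jacobianMatrix,
    dotProduct_stdMatrix_mulVec, dotProduct_stdMatrix_mulVec, fderiv_Fhat_phi S e F hF,
    starProjection_map_phi, inner_phi, inner_phi, smul_eq_mul]

end MultistageModel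

theorem real_inner_starProjection_self_nonneg {H : Type*} [NormedAddCommGroup H]
    [InnerProductSpace ℝ H] (M : Submodule ℝ H) [M.HasOrthogonalProjection] (h : H) :
    0 ≤ inner ℝ h (M.starProjection h) := by
  rw [← M.isIdempotentElem_starProjection.eq, mul_apply_eq_comp,
    ← M.inner_starProjection_left_eq_right]
  exact real_inner_self_nonneg

/-! ### Monotonicity of $\mathcal F+sP_{\mathcal M_n}$ and conclusion. -/

theorem mainTheorem8 {N : ℕ} (S : MultistageModel.{u} N)
    (e : Fin S.J ≃ S.Scenario)
    (C : S.Scenario → Set S.Decision)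
    (hC_ne : ∀ ξ, (C ξ).Nonempty) (hC_closed : ∀ ξ, IsClosed (C ξ))
    (hC_convex : ∀ ξ, Convex ℝ (C ξ))
    (F : S.Decision → S.Scenario → S.Decision)
    (C₀ : Set S.L) (hC₀_open : IsOpen C₀) (hC₀_convex : Convex ℝ C₀)
    (hCC₀ : S.constraintSet C ⊆ C₀)
    (hF_diff : ContDiffOn ℝ 1 (S.nemytskii F) C₀)
    (hF_pseudo : PseudomonotoneOn (S.nemytskii F) C₀)
    (hF_symm : ∀ x ∈ S.phi e '' C₀, (jacobianMatrix (S.Fhat e F) x).IsSymm)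
    (e₂ : ℝ) (he₂ : 0 < e₂)
    (hblock : ∀ x ∈ S.phi e '' C₀,
      IsPairedBlockDiagonal (jacobianMatrix (S.Fhat e F) x +
        e₂ • stdMatrix (S.mult.map (S.phi e)).starProjection)) :
    ∀ s : ℝ, e₂ ≤ s →
      MonotonicityElicitedAt (S.nemytskii F) (S.constraintSet C) S.mult s := by
  intro s hs
  refine ⟨he₂.trans_le hs, ?_⟩
  have hdiffAt : ∀ x ∈ C₀, DifferentiableAt ℝ (S.nemytskii F) x := fun x hx =>
    (hF_diff.contDiffAt (hC₀_open.mem_nhds hx)).differentiableAt one_ne_zero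
  have hpsd : ∀ x ∈ C₀, ∀ h, 0 ≤ inner ℝ h (fderiv ℝ (S.nemytskii F) x h) +
      e₂ * inner ℝ h (S.mult.starProjection h) := by
    intro x hx h
    rw [← S.dotProduct_jacobianMatrix_add_projection e F (hdiffAt x hx)]
    -- The hyperplane is the one orthogonal to $\phi(\mathcal F(x))$; if this vector vanishes, the
    -- condition covers the whole space and the argument is unaffected.
    refine (hblock _ ⟨x, hx, rfl⟩).nonneg_of_nonneg_on_hyperplane
      (w := (S.phi e (S.nemytskii F x)).ofLp) (fun g hg => ?_) _
    obtain ⟨g, rfl⟩ := (WithLp.ofLp_surjective 2) g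
    obtain ⟨g, rfl⟩ := S.phi_surjective e g
    rw [S.dotProduct_jacobianMatrix_add_projection e F (hdiffAt x hx)]
    have hg' : inner ℝ g (S.nemytskii F x) = 0 := by
      rw [← S.inner_phi e, EuclideanSpace.inner_eq_star_dotProduct, dotProduct_comm]
      simpa using hg
    exact add_nonneg
      (hF_pseudo.inner_deriv_nonneg hC₀_open hx (hdiffAt x hx).hasFDerivAt hg')
      (mul_nonneg he₂.le (real_inner_starProjection_self_nonneg _ _))
  set G : S.L → S.L := fun x => S.nemytskii F x + s • S.mult.starProjection x with hGdef
  have hG_diff : ContDiffOn ℝ 1 G C₀ :=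
    hF_diff.add (S.mult.starProjection.contDiff.const_smul s).contDiffOn
  have hG_mono : ∀ x ∈ C₀, ∀ y ∈ C₀, 0 ≤ inner ℝ (G x - G y) (x - y) := by
    intro x hx y hy
    refine inner_sub_nonneg_of_deriv_nonneg (G' := fun x => fderiv ℝ (S.nemytskii F) x +
      s • S.mult.starProjection) hC₀_convex (fun x hx => ?_) (fun x hx h => ?_) hy hx
    · exact (hdiffAt x hx).hasFDerivAt.add (S.mult.starProjection.hasFDerivAt.const_smul s)
    · have h1 := hpsd x hx h
      -- Raising the level from $\hat e_2$ to $s$ only adds the nonnegative form of $(s-\hat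
      -- e_2)P_{\mathcal M_n}$.
      have h2 := mul_le_mul_of_nonneg_right hs
        (real_inner_starProjection_self_nonneg S.mult h)
      simp only [add_apply, smul_apply, inner_add_right, real_inner_smul_right]
      linarith
  have hne : (S.constraintSet C).Nonempty :=
    ⟨fun ξ => (hC_ne ξ).some, fun ξ => (hC_ne ξ).some_mem⟩
  have hclosed : IsClosed (S.constraintSet C) := by
    have h (ξ : S.Scenario) : Continuous fun x : S.L => x ξ :=
      LinearMap.continuous_of_finiteDimensional
        ({ toFun := fun x => x ξ, map_add' := fun _ _ => rfl, map_smul' := fun _ _ => rfl } :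
          S.L →ₗ[ℝ] S.Decision)
    simp only [MultistageModel.constraintSet, Set.ofPred_forall]
    exact isClosed_iInter fun ξ => (hC_closed ξ).preimage (h ξ)
  have hconvex : Convex ℝ (S.constraintSet C) := fun x hx y hy a b ha hb hab ξ =>
    hC_convex ξ (hx ξ) (hy ξ) ha hb hab
  have hGC : ∀ x ∈ S.constraintSet C, ∀ y ∈ S.constraintSet C,
      0 ≤ inner ℝ (G x - G y) (x - y) := fun x hx y hy => hG_mono x (hCC₀ hx) y (hCC₀ hy)
  convert isMaximalMonotoneMap_add_normalConeMap hGC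
    (exists_resolvent_of_contDiffOn hne hclosed hconvex hC₀_open hCC₀ hG_diff hGC) using 6
  simp only [hGdef]
  rw [add_right_comm]
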